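/- Let $1<\alpha<2$, $\frac1\alpha+\frac1{\alpha'}=1$ and $p\ge\alpha'$. Let $\mathbb D$ be the open unit disc in $\mathbb C$, let $dm$ be area measure on $\mathbb D$, and for $a\in\mathbb D$ put $$d\mu_a(z,w)=\frac{(1-|w|)^2(1-|a|)^2}{|1-\overline z w|^4\,|1-\overline w a|^4}\,dm(z)\,dm(w)\qquad\text{on }\mathbb D\times\mathbb D .$$ For an analytic function $F$ on $\mathbb D$ let $\|F\|_{\mathcal B}=\sup_{z\in\mathbb D}|F'(z)|(1-|z|)\in[0,\infty]$, and let $S_3=S_3(F)$ be the class of all measurable functions $\omega:\mathbb D\times\mathbb D\to[0,\infty)$ such that $$\sup_{a\in\mathbb D}\int_{\mathbb D}\int_{\mathbb D}|F'(z)|^{\alpha'(p-1)}\,\omega(z,w)^{-\alpha'}\,(1-|z|)^{p\alpha'}\,d\mu_a(z,w)\le 1$$ (with $0^{-\alpha'}=\infty$ and $0\cdot\infty=0$). Then there are constants $c,C>0$, depending only on $\alpha$ and $p$, such that for every analytic $F$ on $\mathbb D$ with $F(0)=0$ $$c\,\|F\|_{\mathcal B}^{p}\;\le\;\inf_{\omega\in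 S_3(F)}\ \sup_{a\in\mathbb D}\left(\int_{\mathbb D}\int_{\mathbb D}\omega(z,w)^\alpha|F'(z)|^\alpha\,d\mu_a(z,w)\right)^{1/\alpha}\;\le\;C\,\|F\|_{\mathcal B}^{p},$$ where all quantities take values in $[0,\infty]$; in particular, the infimum is finite if and only if $F$ belongs to the Bloch space. -/

import Mathlib

open MeasureTheory
open scoped ENNReal NNReal ComplexConjugate

/-- The open unit disc `𝔻` in `ℂ`. -/
def disc : Set ℂ := Metric.ball 0 1

/-- The Bloch seminorm `sup_{z ∈ 𝔻} |F'(z)| (1 - |z|)`, with value `∞` when `F` is not a Bloch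
function. -/
noncomputable def blochSeminorm (F : ℂ → ℂ) : ℝ≥0∞ :=
  ⨆ z ∈ disc, ‖deriv F z‖ₑ * ENNReal.ofReal (1 - ‖z‖)

/-- The measure `dμ_a(z, w)` on `𝔻 × 𝔻` (extended by zero to `ℂ × ℂ`): the product of area
measures with density `(1 - |w|)² (1 - |a|)² / (|1 - z̄ w|⁴ |1 - w̄ a|⁴)`. -/
noncomputable def muMeasure (a : ℂ) : Measure (ℂ × ℂ) :=
  (volume.restrict (disc ×ˢ disc)).withDensity fun q =>
    ENNReal.ofReal (((1 - ‖q.2‖) ^ 2 * (1 - ‖a‖) ^ 2) /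
      (‖1 - conj q.1 * q.2‖ ^ 4 * ‖1 - conj q.2 * a‖ ^ 4))

/-- The class of weights `S₃` attached to `F`, with parameters `p` and `α'` (written `α'` for the
conjugate exponent of `α`): Lebesgue measurable `ω ≥ 0` on `𝔻 × 𝔻` such that
`sup_{a ∈ 𝔻} ∬ |F'(z)|^{α'(p-1)} ω(z,w)^{-α'} (1-|z|)^{pα'} dμ_a(z,w) ≤ 1`.
The powers are taken in `[0, ∞]`, so `0 ^ (-α') = ∞`. -/
def weightClass (F : ℂ → ℂ) (p α' : ℝ) : Set (ℂ × ℂ → ℝ≥0) :=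
  {ω | AEMeasurable ω (volume.restrict (disc ×ˢ disc)) ∧
    (⨆ a ∈ disc, ∫⁻ q, ‖deriv F q.1‖ₑ ^ (α' * (p - 1)) * (ω q : ℝ≥0∞) ^ (-α') *
      ENNReal.ofReal (1 - ‖q.1‖) ^ (p * α') ∂(muMeasure a)) ≤ 1}

/-- The functional `sup_{a ∈ 𝔻} (∬ ω(z,w)^α |F'(z)|^α dμ_a(z,w))^{1/α}`. -/
noncomputable def weightedSup (F : ℂ → ℂ) (α : ℝ) (ω : ℂ × ℂ → ℝ≥0) : ℝ≥0∞ :=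
  ⨆ a ∈ disc, (∫⁻ q, (ω q : ℝ≥0∞) ^ α * ‖deriv F q.1‖ₑ ^ α ∂(muMeasure a)) ^ (1 / α)

/-! Both bounds compare with the weight-free integral of `|F'(z)|^p (1-|z|)^p` against `μ_a`.

Lower bound: Hölder's inequality cancels `ω` and bounds this integral by the functional
(`lintegral_muMeasure_le_weightedSup`). On pairs of points within `(1-|a|)/2` of `a`, the density of
`μ_a` is at least a constant times `(1-|a|)^(-4)`, so the sub-mean value property of `|F'|^p` bounds
the integral below by a multiple of `(|F'(a)|(1-|a|))^p`
(`enorm_deriv_mul_rpow_le_lintegral_muMeasure`).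

Upper bound: the masses of the `μ_a` are uniformly bounded (`muMeasure_univ_le`). The weight `K
|F'|^(p-1) (1-|z|)^p` makes the integrand defining the class at most a constant, while `ω |F'| = K
(|F'|(1-|z|))^p` is at most `K` times the `p`-th power of the Bloch seminorm. -/

/-! ### Möbius maps and the total mass of `μ_a` -/

theorem norm_one_sub_conj_mul_comm (z w : ℂ) : ‖1 - conj z * w‖ = ‖1 - conj w * z‖ := by
  rw [← Complex.norm_conj]
  simp [mul_comm]

theorem one_sub_conj_mul_ne_zero {z w : ℂ} (hz : ‖z‖ < 1) (hw : ‖w‖ < 1) :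
    1 - conj w * z ≠ 0 := by
  intro h
  have h1 : ‖conj w * z‖ = 1 := by rw [← sub_eq_zero.mp h, norm_one]
  rw [norm_mul, Complex.norm_conj] at h1
  nlinarith [norm_nonneg z, norm_nonneg w]

/-- The Möbius map `z ↦ (z - w) / (1 - w̄ z)` sends the disc into itself. -/
theorem moebius_mem_disc {z w : ℂ} (hz : ‖z‖ < 1) (hw : ‖w‖ < 1) :
    ‖(z - w) / (1 - conj w * z)‖ < 1 := by
  have hne := one_sub_conj_mul_ne_zero hz hw
  rw [norm_div, div_lt_one (norm_pos_iff.mpr hne), ← sq_lt_sq₀ (norm_nonneg _) (norm_nonneg _)]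
  have key : ‖1 - conj w * z‖ ^ 2 - ‖z - w‖ ^ 2 = (1 - ‖z‖ ^ 2) * (1 - ‖w‖ ^ 2) := by
    simp only [← Complex.normSq_eq_norm_sq, Complex.normSq_apply, Complex.sub_re, Complex.sub_im,
      Complex.mul_re, Complex.mul_im, Complex.conj_re, Complex.conj_im, Complex.one_re,
      Complex.one_im]
    ring
  have : 0 < (1 - ‖z‖ ^ 2) * (1 - ‖w‖ ^ 2) := by
    apply mul_pos <;> nlinarith [norm_nonneg z, norm_nonneg w]
  linarith

theorem injOn_moebius {w : ℂ} (hw : ‖w‖ < 1) :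
    Set.InjOn (fun z : ℂ => (z - w) / (1 - conj w * z)) disc := by
  intro x hx y hy hxy
  rw [disc, mem_ball_zero_iff] at hx hy
  rw [div_eq_div_iff (one_sub_conj_mul_ne_zero hx hw) (one_sub_conj_mul_ne_zero hy hw)] at hxy
  have h : (x - y) * (1 - conj w * w) = 0 := by linear_combination hxy
  rcases mul_eq_zero.mp h with h | h
  · exact sub_eq_zero.mp h
  · exact absurd h (one_sub_conj_mul_ne_zero hw hw)

theorem hasDerivAt_moebius {z w : ℂ} (h : 1 - conj w * z ≠ 0) :
    HasDerivAt (fun z : ℂ => (z - w) / (1 - conj w * z))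
      ((1 - conj w * w) / (1 - conj w * z) ^ 2) z := by
  have h1 : HasDerivAt (fun z : ℂ => z - w) 1 z := (hasDerivAt_id z).sub_const w
  have h2 : HasDerivAt (fun z : ℂ => 1 - conj w * z) (-(conj w)) z := by
    simpa using ((hasDerivAt_id z).const_mul (conj w)).const_sub 1
  refine (h1.div h2 h).congr_deriv ?_
  congr 1
  ring

/-- The area of the image of a set under an injective holomorphic map. -/
theorem lintegral_sq_norm_deriv_eq_volume_image {f f' : ℂ → ℂ} {s : Set ℂ} (hs : MeasurableSet s)
    (hf : ∀ z ∈ s, HasDerivAt f (f' z) z) (hinj : Set.InjOn f s) :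
    ∫⁻ z in s, ENNReal.ofReal (‖f' z‖ ^ 2) = volume (f '' s) := by
  rw [← lintegral_abs_det_fderiv_eq_addHaar_image volume hs
    (fun z hz => ((hf z hz).hasFDerivAt.restrictScalars ℝ).hasFDerivWithinAt) hinj]
  refine lintegral_congr fun z => ?_
  congr 1
  -- Multiplication by `f'`, seen as a real-linear map, has determinant `|f'|^2`.
  simp [ContinuousLinearMap.det, LinearMap.det_restrictScalars, Algebra.norm_complex_eq,
    Complex.normSq_eq_norm_sq]

/-- Since `1-|w| ≤ 1-|w|^2`, the kernel is at most the Jacobian of an injective Möbius map from the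
disc into itself. -/
theorem lintegral_disc_kernel_le {w : ℂ} (hw : ‖w‖ < 1) :
    ∫⁻ z in disc, ENNReal.ofReal ((1 - ‖w‖) ^ 2 / ‖1 - conj w * z‖ ^ 4) ≤ volume disc := by
  have hmeas : MeasurableSet disc := measurableSet_ball
  have hlt : ∀ z ∈ disc, ‖z‖ < 1 := fun z hz => mem_ball_zero_iff.mp hz
  calc _ ≤ ∫⁻ z in disc, ENNReal.ofReal (‖(1 - conj w * w) / (1 - conj w * z) ^ 2‖ ^ 2) := by
        refine lintegral_mono fun z => ENNReal.ofReal_le_ofReal ?_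
        have h1 : 1 - ‖w‖ ≤ ‖1 - conj w * w‖ := by
          have := norm_sub_norm_le (1 : ℂ) (conj w * w)
          rw [norm_one, norm_mul, Complex.norm_conj] at this
          nlinarith [norm_nonneg w]
        rw [norm_div, norm_pow, div_pow, ← pow_mul]
        gcongr
    _ = volume ((fun z : ℂ => (z - w) / (1 - conj w * z)) '' disc) :=
        lintegral_sq_norm_deriv_eq_volume_image hmeas
          (fun z hz => hasDerivAt_moebius (one_sub_conj_mul_ne_zero (hlt z hz) hw))
          (injOn_moebius hw)
    _ ≤ volume disc := by
        refine measure_mono ?_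
        rintro _ ⟨z, hz, rfl⟩
        exact mem_ball_zero_iff.mpr (moebius_mem_disc (hlt z hz) hw)

theorem measurable_muMeasure_density (a : ℂ) : Measurable fun q : ℂ × ℂ =>
    ENNReal.ofReal (((1 - ‖q.2‖) ^ 2 * (1 - ‖a‖) ^ 2) /
      (‖1 - conj q.1 * q.2‖ ^ 4 * ‖1 - conj q.2 * a‖ ^ 4)) := by
  have : Measurable (conj : ℂ → ℂ) := Complex.continuous_conj.measurable
  fun_prop

/-- Integrating in `z` first uses up the factor `(1-|w|)^2`; what remains is the same kernel in `w`,
with pole parameter `a`. -/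
theorem muMeasure_univ_le {a : ℂ} (ha : ‖a‖ < 1) :
    muMeasure a Set.univ ≤ volume disc * volume disc := by
  have hconj : Measurable (conj : ℂ → ℂ) := Complex.continuous_conj.measurable
  have hmeas : MeasurableSet disc := measurableSet_ball
  rw [muMeasure, withDensity_apply _ MeasurableSet.univ, Measure.restrict_univ,
    Measure.volume_eq_prod, ← Measure.prod_restrict,
    lintegral_prod_symm' _ (measurable_muMeasure_density a)]
  calc _ ≤ ∫⁻ w in disc, ENNReal.ofReal ((1 - ‖a‖) ^ 2 / ‖1 - conj a * w‖ ^ 4) * volume disc := by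
        refine setLIntegral_mono (by fun_prop) fun w hw => ?_
        refine le_trans (le_of_eq ?_)
          (mul_le_mul_right (lintegral_disc_kernel_le (mem_ball_zero_iff.mp hw)) _)
        rw [← lintegral_const_mul _ (by fun_prop)]
        refine lintegral_congr fun z => ?_
        rw [← ENNReal.ofReal_mul (by positivity), norm_one_sub_conj_mul_comm w z,
          norm_one_sub_conj_mul_comm a w, div_mul_div_comm]
        congr 2 <;> ring
    _ ≤ volume disc * volume disc := by
        rw [lintegral_mul_const _ (by fun_prop)]
        gcongr
        exact lintegral_disc_kernel_le ha

/-! ### Sub-mean value inequalities -/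

/-- Mean value inequality on a circle. -/
theorem enorm_mul_le_lintegral_circle {g : ℂ → ℂ} {a : ℂ} {r s : ℝ}
    (hg : DifferentiableOn ℂ g (Metric.ball a r)) (hs : 0 < s) (hsr : s < r) :
    ‖g a‖ₑ * ENNReal.ofReal (2 * Real.pi) ≤
      ∫⁻ θ in Set.Ioo (-Real.pi) Real.pi, ‖g (circleMap a s θ)‖ₑ := by
  have hd : DiffContOnCl ℂ g (Metric.ball a |s|) := by
    rw [abs_of_pos hs]
    exact (hg.mono (Metric.closure_ball_subset_closedBall.trans
      (Metric.closedBall_subset_ball hsr))).diffContOnCl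
  have h1 := hd.circleAverage
  -- Periodicity moves the circle average from `[0, 2π]` to `(-π, π)`, the angular range of
  -- `polarCoord`.
  have hper : Function.Periodic (fun θ => g (circleMap a s θ)) (2 * Real.pi) :=
    (periodic_circleMap a s).comp g
  have h2 := hper.intervalIntegral_add_eq 0 (-Real.pi)
  rw [zero_add, show -Real.pi + 2 * Real.pi = Real.pi by ring] at h2
  rw [Real.circleAverage_def, h2,
    intervalIntegral.integral_of_le (by linarith [Real.pi_pos])] at h1
  have h3 : (2 * Real.pi) • g a = ∫ θ in Set.Ioc (-Real.pi) Real.pi, g (circleMap a s θ) := by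
    rw [← h1, smul_smul, mul_inv_cancel₀ (by positivity), one_smul]
  have h4 : ‖(2 * Real.pi) • g a‖ₑ = ENNReal.ofReal (2 * Real.pi) * ‖g a‖ₑ := by
    rw [enorm_smul, Real.enorm_eq_ofReal (by positivity)]
  rw [mul_comm, ← h4, h3, restrict_Ioo_eq_restrict_Ioc]
  exact enorm_integral_le_lintegral_enorm _

/-- Lebesgue integral over a disc in polar coordinates. -/
theorem setLIntegral_ball_eq_lintegral_circleMap {f : ℂ → ℝ≥0∞} (hf : Measurable f) (a : ℂ)
    (r : ℝ) :
    ∫⁻ z in Metric.ball a r, f z = ∫⁻ s in Set.Ioo 0 r, ENNReal.ofReal s *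
      ∫⁻ θ in Set.Ioo (-Real.pi) Real.pi, f (circleMap a s θ) := by
  rw [← lintegral_indicator measurableSet_ball,
    ← lintegral_add_left_eq_self ((Metric.ball a r).indicator f) a,
    ← Complex.lintegral_comp_polarCoord_symm, polarCoord_target, Measure.volume_eq_prod,
    ← Measure.prod_restrict]
  have hF : Measurable fun q : ℝ × ℝ => ENNReal.ofReal q.1 •
      (Metric.ball a r).indicator f (a + Complex.polarCoord.symm q) := by
    simp only [Complex.polarCoord_symm_apply, smul_eq_mul]
    have := hf.indicator (measurableSet_ball (x := a) (ε := r))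
    fun_prop
  rw [lintegral_prod _ hF.aemeasurable, ← lintegral_indicator measurableSet_Ioi,
    ← lintegral_indicator measurableSet_Ioo]
  refine lintegral_congr fun s => ?_
  by_cases hs : 0 < s
  swap
  · rw [Set.indicator_of_notMem (by simpa using hs),
      Set.indicator_of_notMem (fun h => hs h.1)]
  have hmap : ∀ θ : ℝ, a + Complex.polarCoord.symm (s, θ) = circleMap a s θ := by
    intro θ
    simp [circleMap, Complex.exp_mul_I]
  have hmem : ∀ θ : ℝ, circleMap a s θ ∈ Metric.ball a r ↔ s < r := by
    intro θ
    simp [circleMap, abs_of_pos hs]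
  rw [Set.indicator_of_mem (show s ∈ Set.Ioi 0 from hs)]
  simp only [hmap, smul_eq_mul]
  by_cases hsr : s < r
  · rw [Set.indicator_of_mem (show s ∈ Set.Ioo 0 r from ⟨hs, hsr⟩),
      ← lintegral_const_mul _ (by fun_prop)]
    refine lintegral_congr fun θ => ?_
    rw [Set.indicator_of_mem ((hmem θ).mpr hsr)]
  · rw [Set.indicator_of_notMem (fun h => hsr h.2)]
    simp [Set.indicator_of_notMem, hmem, hsr]

/-- Mean value inequality on a disc. -/
theorem enorm_mul_volume_ball_le_lintegral {g : ℂ → ℂ} {a : ℂ} {r : ℝ} (hm : Measurable g)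
    (hg : DifferentiableOn ℂ g (Metric.ball a r)) :
    ‖g a‖ₑ * volume (Metric.ball a r) ≤ ∫⁻ z in Metric.ball a r, ‖g z‖ₑ := by
  rw [← setLIntegral_const, setLIntegral_ball_eq_lintegral_circleMap measurable_const,
    setLIntegral_ball_eq_lintegral_circleMap hm.enorm]
  refine setLIntegral_mono' measurableSet_Ioo fun s hs => ?_
  gcongr ENNReal.ofReal s * ?_
  refine le_trans (le_of_eq ?_) (enorm_mul_le_lintegral_circle hg hs.1 hs.2)
  rw [setLIntegral_const, Real.volume_Ioo]
  congr 2
  ring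

/-- Sub-mean value property of `‖g‖ ^ p` for holomorphic `g` and `1 ≤ p`. -/
theorem enorm_rpow_mul_volume_ball_le_lintegral {g : ℂ → ℂ} {a : ℂ} {r p : ℝ} (hp : 1 ≤ p)
    (hr : 0 < r) (hm : Measurable g) (hg : DifferentiableOn ℂ g (Metric.ball a r)) :
    ‖g a‖ₑ ^ p * volume (Metric.ball a r) ≤ ∫⁻ z in Metric.ball a r, ‖g z‖ₑ ^ p := by
  set V := volume (Metric.ball a r) with hV
  have hV0 : V ≠ 0 := (Metric.measure_ball_pos volume a hr).ne'
  have hVt : V ≠ ∞ := measure_ball_lt_top.ne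
  have hp0 : 0 < p := by linarith
  have h1 := enorm_mul_volume_ball_le_lintegral hm hg
  -- Jensen's inequality, in the form of the comparison of `L^1` and `L^p` norms on a ball of finite
  -- measure `V`.
  have h2 := eLpNorm'_le_eLpNorm'_mul_rpow_measure_univ (f := g) one_pos hp
    (μ := volume.restrict (Metric.ball a r)) hm.aestronglyMeasurable
  simp only [eLpNorm', ENNReal.rpow_one, div_one, Measure.restrict_apply_univ, ← hV] at h2
  have h3 := ENNReal.rpow_le_rpow (h1.trans h2) hp0.le
  rw [ENNReal.mul_rpow_of_nonneg _ _ hp0.le, ENNReal.mul_rpow_of_nonneg _ _ hp0.le,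
    ← ENNReal.rpow_mul, one_div, inv_mul_cancel₀ hp0.ne', ENNReal.rpow_one, ← ENNReal.rpow_mul,
    sub_mul, one_mul, inv_mul_cancel₀ hp0.ne', ENNReal.rpow_sub _ _ hV0 hVt, ENNReal.rpow_one,
    ← hV] at h3
  have hVp0 : V ^ p ≠ 0 := by simp [hV0, hVt]
  have hVpt : V ^ p ≠ ∞ := by simp [hV0, hVt]
  calc ‖g a‖ₑ ^ p * V = (‖g a‖ₑ ^ p * V ^ p) * (V / V ^ p) := by
        rw [mul_assoc, ENNReal.mul_div_cancel hVp0 hVpt]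
    _ ≤ ((∫⁻ z in Metric.ball a r, ‖g z‖ₑ ^ p) * (V ^ p / V)) * (V / V ^ p) := by gcongr
    _ = ∫⁻ z in Metric.ball a r, ‖g z‖ₑ ^ p := by
        rw [mul_assoc, ← mul_div_assoc, ENNReal.div_mul_cancel hV0 hVt, ENNReal.div_self hVp0 hVpt,
          mul_one]

/-! ### Lower bound by localization near `(a, a)` -/

/-- The density of `muMeasure a` near the point `(a, a)`. -/
theorem muMeasure_density_ge {a z w : ℂ} (ha : ‖a‖ < 1) (hz : ‖z - a‖ < (1 - ‖a‖) / 2)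
    (hw : ‖w - a‖ < (1 - ‖a‖) / 2) :
    1 / (26244 * (1 - ‖a‖) ^ 4) ≤ ((1 - ‖w‖) ^ 2 * (1 - ‖a‖) ^ 2) /
      (‖1 - conj z * w‖ ^ 4 * ‖1 - conj w * a‖ ^ 4) := by
  have key : ∀ u v : ℂ, ‖u - a‖ < (1 - ‖a‖) / 2 → ‖v - a‖ < (1 - ‖a‖) / 2 →
      0 < ‖1 - conj u * v‖ ∧ ‖1 - conj u * v‖ ≤ 3 * (1 - ‖a‖) := by
    intro u v hu hv
    have hu' : ‖u‖ < 1 := by linarith [norm_sub_norm_le u a]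
    have hv' : ‖v‖ < 1 := by linarith [norm_sub_norm_le v a]
    refine ⟨norm_pos_iff.mpr (one_sub_conj_mul_ne_zero hv' hu'), ?_⟩
    -- With `δ = 1-|a|`, the three terms are at most `2δ`, `δ/2` and `δ/2` in modulus, hence the
    -- factor 3; then `26244 = 4 * 3^8`.
    have e : 1 - conj u * v = ((1 - ‖a‖ ^ 2 : ℝ) : ℂ) - conj (u - a) * v - conj a * (v - a) := by
      have : (conj a) * a = ((‖a‖ ^ 2 : ℝ) : ℂ) := by
        rw [← Complex.normSq_eq_norm_sq, mul_comm, Complex.mul_conj]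
      push_cast at this ⊢
      rw [map_sub, ← this]
      ring
    have h1 := norm_sub_le (((1 - ‖a‖ ^ 2 : ℝ) : ℂ) - conj (u - a) * v) (conj a * (v - a))
    have h2 := norm_sub_le ((1 - ‖a‖ ^ 2 : ℝ) : ℂ) (conj (u - a) * v)
    have h3 : 0 ≤ 1 - ‖a‖ ^ 2 := by nlinarith [norm_nonneg a]
    rw [← e] at h1
    rw [Complex.norm_real, Real.norm_eq_abs, abs_of_nonneg h3, norm_mul, Complex.norm_conj] at h2
    rw [norm_mul, Complex.norm_conj] at h1
    nlinarith [norm_nonneg a, norm_nonneg (u - a), norm_nonneg (v - a), norm_nonneg v]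
  have ha' : ‖a - a‖ < (1 - ‖a‖) / 2 := by simp [ha]
  obtain ⟨h1, h2⟩ := key z w hz hw
  obtain ⟨h3, h4⟩ := key w a hw ha'
  have hδ : 0 < 1 - ‖a‖ := by linarith
  have h5 : (1 - ‖a‖) / 2 ≤ 1 - ‖w‖ := by linarith [norm_sub_norm_le w a]
  calc 1 / (26244 * (1 - ‖a‖) ^ 4) = (((1 - ‖a‖) / 2) ^ 2 * (1 - ‖a‖) ^ 2) /
        ((3 * (1 - ‖a‖)) ^ 4 * (3 * (1 - ‖a‖)) ^ 4) := by
        field_simp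
        norm_num
    _ ≤ _ := by gcongr

/-- The two ball areas `π δ^2 / 4` cancel the `δ^(-4)` of the density, with `419904 = 16 * 26244`;
`(1/2)^p` comes from `1-|z| ≥ δ/2`. -/
theorem enorm_deriv_mul_rpow_le_lintegral_muMeasure {F : ℂ → ℂ} (hF : DifferentiableOn ℂ F disc)
    {p : ℝ} (hp : 1 ≤ p) {a : ℂ} (ha : ‖a‖ < 1) :
    ENNReal.ofReal ((1 / 2) ^ p * Real.pi ^ 2 / 419904) *
        (‖deriv F a‖ₑ * ENNReal.ofReal (1 - ‖a‖)) ^ p ≤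
      ∫⁻ q, ‖deriv F q.1‖ₑ ^ p * ENNReal.ofReal (1 - ‖q.1‖) ^ p ∂(muMeasure a) := by
  have hp0 : 0 ≤ p := by linarith
  have hδ : 0 < 1 - ‖a‖ := by linarith
  have hdm : Measurable (deriv F) := measurable_deriv F
  set δ := 1 - ‖a‖ with hδdef
  have hnear : ∀ z ∈ Metric.ball a (δ / 2), ‖z - a‖ < δ / 2 := fun z hz => mem_ball_iff_norm.mp hz
  have hsub : Metric.ball a (δ / 2) ⊆ disc := fun z hz =>
    mem_ball_zero_iff.mpr (by linarith [norm_sub_norm_le z a, hnear z hz])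
  have hmean := enorm_rpow_mul_volume_ball_le_lintegral hp (half_pos hδ) hdm
    ((hF.deriv Metric.isOpen_ball).mono hsub)
  have hV : volume (Metric.ball a (δ / 2)) = ENNReal.ofReal (Real.pi * (δ / 2) ^ 2) := by
    rw [Complex.volume_ball, mul_comm, ENNReal.ofReal_mul Real.pi_pos.le,
      ENNReal.ofReal_pow (by positivity)]
    congr 1
    rw [← NNReal.coe_real_pi, ENNReal.ofReal_coe_nnreal]
  rw [muMeasure, lintegral_withDensity_eq_lintegral_mul _ (measurable_muMeasure_density a)
    (by fun_prop)]
  calc _ = (ENNReal.ofReal (1 / (26244 * δ ^ 4)) * ENNReal.ofReal (δ / 2) ^ p *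
        volume (Metric.ball a (δ / 2))) *
          (‖deriv F a‖ₑ ^ p * volume (Metric.ball a (δ / 2))) := by
        rw [hV, ENNReal.mul_rpow_of_nonneg _ _ hp0, ENNReal.ofReal_rpow_of_pos hδ,
          ENNReal.ofReal_rpow_of_pos (half_pos hδ), mul_left_comm, mul_left_comm _ (_ ^ p),
          ← ENNReal.ofReal_mul (by positivity), ← ENNReal.ofReal_mul (by positivity),
          ← ENNReal.ofReal_mul (by positivity), ← ENNReal.ofReal_mul (by positivity)]
        congr 2
        rw [div_eq_mul_one_div δ 2, Real.mul_rpow hδ.le (by positivity)]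
        field_simp
        norm_num
    _ ≤ (ENNReal.ofReal (1 / (26244 * δ ^ 4)) * ENNReal.ofReal (δ / 2) ^ p *
        volume (Metric.ball a (δ / 2))) * ∫⁻ z in Metric.ball a (δ / 2), ‖deriv F z‖ₑ ^ p := by
        gcongr
    _ = ∫⁻ q in Metric.ball a (δ / 2) ×ˢ Metric.ball a (δ / 2),
        ENNReal.ofReal (1 / (26244 * δ ^ 4)) *
          (‖deriv F q.1‖ₑ ^ p * ENNReal.ofReal (δ / 2) ^ p) := by
        rw [Measure.volume_eq_prod, ← Measure.prod_restrict,
          lintegral_prod _ (Measurable.aemeasurable (by fun_prop))]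
        simp only [lintegral_const, Measure.restrict_apply_univ]
        rw [lintegral_mul_const _ (by fun_prop), lintegral_const_mul _ (by fun_prop),
          lintegral_mul_const _ (by fun_prop)]
        ring
    _ ≤ ∫⁻ q in Metric.ball a (δ / 2) ×ˢ Metric.ball a (δ / 2), _ := by
        refine setLIntegral_mono' (measurableSet_ball.prod measurableSet_ball) fun q hq => ?_
        refine mul_le_mul' (ENNReal.ofReal_le_ofReal
          (muMeasure_density_ge ha (hnear _ hq.1) (hnear _ hq.2)))
          (mul_le_mul' le_rfl (ENNReal.rpow_le_rpow (ENNReal.ofReal_le_ofReal ?_) hp0))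
        linarith [norm_sub_norm_le q.1 a, hnear _ hq.1]
    _ ≤ _ := lintegral_mono_set (Set.prod_mono hsub hsub)

/-! ### Eliminating the weight by Hölder's inequality -/

theorem aemeasurable_muMeasure_of_restrict {ω : ℂ × ℂ → ℝ≥0}
    (hω : AEMeasurable ω (volume.restrict (disc ×ˢ disc))) (a : ℂ) :
    AEMeasurable ω (muMeasure a) :=
  hω.mono_ac (withDensity_absolutelyContinuous _ _)

/-- Hölder's inequality for a weight in `weightClass F p α'`. -/
theorem lintegral_muMeasure_le_weightedSup {α α' p : ℝ} (h : α.HolderConjugate α') (hp : 1 < p)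
    {F : ℂ → ℂ} {ω : ℂ × ℂ → ℝ≥0} (hω : ω ∈ weightClass F p α') {a : ℂ} (ha : a ∈ disc) :
    ∫⁻ q, ‖deriv F q.1‖ₑ ^ p * ENNReal.ofReal (1 - ‖q.1‖) ^ p ∂(muMeasure a) ≤
      weightedSup F α ω := by
  obtain ⟨hωm, hω1⟩ := hω
  have hα : 0 < α := h.pos
  have hα' : 0 < α' := h.symm.pos
  have hp0 : 0 < p := by linarith
  have hωa := (aemeasurable_muMeasure_of_restrict hωm a).coe_nnreal_ennreal
  have hdm : Measurable (deriv F) := measurable_deriv F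
  have hI := (le_iSup₂ (f := fun a (_ : a ∈ disc) => ∫⁻ q, ‖deriv F q.1‖ₑ ^ (α' * (p - 1)) *
    (ω q : ℝ≥0∞) ^ (-α') * ENNReal.ofReal (1 - ‖q.1‖) ^ (p * α') ∂(muMeasure a)) a ha).trans hω1
  -- The integrand is finite almost everywhere, so `ω` vanishes almost nowhere on the set where `F'
  -- ≠ 0`; there `ω * ω⁻¹ = 1`.
  have hfin := ae_lt_top' (by fun_prop) (hI.trans_lt ENNReal.one_lt_top).ne
  set f : ℂ × ℂ → ℝ≥0∞ := fun q => ω q * ‖deriv F q.1‖ₑ with hf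
  set g : ℂ × ℂ → ℝ≥0∞ := fun q =>
    ‖deriv F q.1‖ₑ ^ (p - 1) * (ω q : ℝ≥0∞) ^ (-1 : ℝ) * ENNReal.ofReal (1 - ‖q.1‖) ^ p with hg
  have hfα : ∀ q, f q ^ α = (ω q : ℝ≥0∞) ^ α * ‖deriv F q.1‖ₑ ^ α := fun q =>
    ENNReal.mul_rpow_of_nonneg _ _ hα.le
  have hgα : ∀ q, g q ^ α' = ‖deriv F q.1‖ₑ ^ (α' * (p - 1)) * (ω q : ℝ≥0∞) ^ (-α') *
      ENNReal.ofReal (1 - ‖q.1‖) ^ (p * α') := by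
    intro q
    rw [hg, ENNReal.mul_rpow_of_nonneg _ _ hα'.le, ENNReal.mul_rpow_of_nonneg _ _ hα'.le,
      ← ENNReal.rpow_mul, ← ENNReal.rpow_mul, ← ENNReal.rpow_mul]
    ring_nf
  calc _ ≤ ∫⁻ q, (f * g) q ∂(muMeasure a) := by
        refine lintegral_mono_ae ?_
        filter_upwards [hfin] with q hq
        by_cases hD : ‖deriv F q.1‖ₑ = 0
        · simp [hD, hp0]
        by_cases hδ : ENNReal.ofReal (1 - ‖q.1‖) = 0
        · simp [hδ, hp0]
        have hDt : ‖deriv F q.1‖ₑ ≠ ∞ := enorm_ne_top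
        have hω0 : (ω q : ℝ≥0∞) ≠ 0 := by
          intro h0
          rw [h0, ENNReal.zero_rpow_of_neg (neg_lt_zero.mpr hα'),
            ENNReal.mul_top (by simp [ENNReal.rpow_eq_zero_iff, hD, hDt]),
            ENNReal.top_mul (by simp [ENNReal.rpow_eq_zero_iff, hδ])] at hq
          exact hq.false
        refine le_of_eq ?_
        have e1 : ‖deriv F q.1‖ₑ * ‖deriv F q.1‖ₑ ^ (p - 1) = ‖deriv F q.1‖ₑ ^ p := by
          rw [ENNReal.rpow_sub _ _ hD hDt, ENNReal.rpow_one, ENNReal.mul_div_cancel hD hDt]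
        have e2 : (ω q : ℝ≥0∞) * (ω q : ℝ≥0∞) ^ (-1 : ℝ) = 1 := by
          rw [ENNReal.rpow_neg_one, ENNReal.mul_inv_cancel hω0 ENNReal.coe_ne_top]
        calc _ = (‖deriv F q.1‖ₑ * ‖deriv F q.1‖ₑ ^ (p - 1)) *
              ((ω q : ℝ≥0∞) * (ω q : ℝ≥0∞) ^ (-1 : ℝ)) * ENNReal.ofReal (1 - ‖q.1‖) ^ p := by
              rw [e1, e2, mul_one]
          _ = (f * g) q := by
              simp only [Pi.mul_apply, hf, hg]
              ring
    _ ≤ (∫⁻ q, f q ^ α ∂(muMeasure a)) ^ (1 / α) * (∫⁻ q, g q ^ α' ∂(muMeasure a)) ^ (1 / α') :=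
        ENNReal.lintegral_mul_le_Lp_mul_Lq _ h (by fun_prop) (by fun_prop)
    _ ≤ (∫⁻ q, f q ^ α ∂(muMeasure a)) ^ (1 / α) * 1 := by
        gcongr
        simp only [hgα]
        exact ENNReal.rpow_le_one hI (by positivity)
    _ ≤ weightedSup F α ω := by
        rw [mul_one]
        simp only [hfα]
        exact le_iSup₂ (f := fun a (_ : a ∈ disc) => (∫⁻ q, (ω q : ℝ≥0∞) ^ α *
          ‖deriv F q.1‖ₑ ^ α ∂(muMeasure a)) ^ (1 / α)) a ha

/-! ### The explicit weight for the upper bound -/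

/-- The weight `K |F'(z)|^(p-1) (1-|z|)^p`. -/
noncomputable def derivWeight (F : ℂ → ℂ) (p : ℝ) (K : ℝ≥0) (q : ℂ × ℂ) : ℝ≥0 :=
  K * ‖deriv F q.1‖₊ ^ (p - 1) * (1 - ‖q.1‖).toNNReal ^ p

theorem measurable_derivWeight (F : ℂ → ℂ) (p : ℝ) (K : ℝ≥0) : Measurable (derivWeight F p K) := by
  have hdm : Measurable (deriv F) := measurable_deriv F
  unfold derivWeight
  fun_prop

theorem coe_derivWeight {F : ℂ → ℂ} {p : ℝ} (hp : 1 < p) (K : ℝ≥0) (q : ℂ × ℂ) :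
    (derivWeight F p K q : ℝ≥0∞) =
      K * ‖deriv F q.1‖ₑ ^ (p - 1) * ENNReal.ofReal (1 - ‖q.1‖) ^ p := by
  rw [derivWeight, ENNReal.coe_mul, ENNReal.coe_mul, ENNReal.coe_rpow_of_nonneg _ (by linarith),
    ENNReal.coe_rpow_of_nonneg _ (by linarith)]
  rfl

theorem derivWeight_mem_weightClass {α' p : ℝ} (hα' : 0 < α') (hp : 1 < p) {K : ℝ≥0}
    (hK0 : K ≠ 0) (hK : volume disc * volume disc ≤ (K : ℝ≥0∞) ^ α') (F : ℂ → ℂ) :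
    derivWeight F p K ∈ weightClass F p α' := by
  refine ⟨(measurable_derivWeight F p K).aemeasurable, iSup₂_le fun a ha => ?_⟩
  have hKp0 : (K : ℝ≥0∞) ^ α' ≠ 0 := by simp [ENNReal.rpow_eq_zero_iff, hK0]
  have hKpt : (K : ℝ≥0∞) ^ α' ≠ ∞ := by simp [ENNReal.rpow_eq_top_iff, hK0]
  calc _ ≤ ∫⁻ _, ((K : ℝ≥0∞) ^ α')⁻¹ ∂(muMeasure a) := by
        refine lintegral_mono fun q => ?_
        dsimp only
        rw [coe_derivWeight hp]
        set D := ‖deriv F q.1‖ₑ with hDdef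
        set δ := ENNReal.ofReal (1 - ‖q.1‖) with hδdef
        have hDt : D ≠ ∞ := enorm_ne_top
        have hδt : δ ≠ ∞ := ENNReal.ofReal_ne_top
        have h1 : 0 < α' * (p - 1) := mul_pos hα' (by linarith)
        have h2 : 0 < p * α' := mul_pos (by linarith) hα'
        -- Where `F' = 0` the weight vanishes too, and the convention `0 * ∞ = 0` makes the
        -- integrand zero.
        by_cases hD : D = 0
        · simp [hD, h1]
        by_cases hδ : δ = 0
        · simp [hδ, h2]
        have hA0 : D ^ (α' * (p - 1)) * δ ^ (p * α') ≠ 0 := by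
          simp [ENNReal.rpow_eq_zero_iff, hD, hDt, hδ, hδt]
        have hAt : D ^ (α' * (p - 1)) * δ ^ (p * α') ≠ ∞ :=
          ENNReal.mul_ne_top (ENNReal.rpow_ne_top_of_nonneg h1.le hDt)
            (ENNReal.rpow_ne_top_of_nonneg h2.le hδt)
        have e : ((K : ℝ≥0∞) * D ^ (p - 1) * δ ^ p) ^ α' =
            K ^ α' * (D ^ (α' * (p - 1)) * δ ^ (p * α')) := by
          rw [ENNReal.mul_rpow_of_nonneg _ _ hα'.le, ENNReal.mul_rpow_of_nonneg _ _ hα'.le,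
            ← ENNReal.rpow_mul, ← ENNReal.rpow_mul, mul_comm (p - 1), mul_assoc]
        rw [ENNReal.rpow_neg, e, ENNReal.mul_inv (Or.inl hKp0) (Or.inl hKpt), mul_right_comm,
          mul_left_comm, ENNReal.mul_inv_cancel hA0 hAt, mul_one]
    _ = ((K : ℝ≥0∞) ^ α')⁻¹ * muMeasure a Set.univ := lintegral_const _
    _ ≤ ((K : ℝ≥0∞) ^ α')⁻¹ * (K : ℝ≥0∞) ^ α' := by
        gcongr
        exact (muMeasure_univ_le (mem_ball_zero_iff.mp ha)).trans hK
    _ = 1 := ENNReal.inv_mul_cancel hKp0 hKpt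

theorem weightedSup_derivWeight_le {α p : ℝ} (hα : 0 < α) (hp : 1 < p) (K : ℝ≥0) (F : ℂ → ℂ) :
    weightedSup F α (derivWeight F p K) ≤
      K * (volume disc * volume disc) ^ (1 / α) * blochSeminorm F ^ p := by
  refine iSup₂_le fun a ha => ?_
  have hbound : ∀ q ∈ disc ×ˢ (disc : Set ℂ), (derivWeight F p K q : ℝ≥0∞) * ‖deriv F q.1‖ₑ ≤
      K * blochSeminorm F ^ p := by
    intro q hq
    have hB : ‖deriv F q.1‖ₑ * ENNReal.ofReal (1 - ‖q.1‖) ≤ blochSeminorm F :=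
      le_iSup₂ (f := fun z (_ : z ∈ disc) => ‖deriv F z‖ₑ * ENNReal.ofReal (1 - ‖z‖)) q.1 hq.1
    have e : ‖deriv F q.1‖ₑ ^ (p - 1) * ‖deriv F q.1‖ₑ = ‖deriv F q.1‖ₑ ^ p := by
      nth_rewrite 2 [← ENNReal.rpow_one ‖deriv F q.1‖ₑ]
      rw [← ENNReal.rpow_add_of_nonneg _ _ (by linarith) zero_le_one, sub_add_cancel]
    calc _ = K * ((‖deriv F q.1‖ₑ ^ (p - 1) * ‖deriv F q.1‖ₑ) *
          ENNReal.ofReal (1 - ‖q.1‖) ^ p) := by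
          rw [coe_derivWeight hp]
          ring
      _ = K * (‖deriv F q.1‖ₑ * ENNReal.ofReal (1 - ‖q.1‖)) ^ p := by
          rw [e, ENNReal.mul_rpow_of_nonneg _ _ (by linarith)]
      _ ≤ _ := by gcongr
  have hae : ∀ᵐ q ∂(muMeasure a), q ∈ disc ×ˢ (disc : Set ℂ) :=
    (withDensity_absolutelyContinuous _ _).ae_le
      (ae_restrict_mem (measurableSet_ball.prod measurableSet_ball))
  calc _ ≤ (∫⁻ _, (K * blochSeminorm F ^ p) ^ α ∂(muMeasure a)) ^ (1 / α) := by
        gcongr ?_ ^ (1 / α)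
        refine lintegral_mono_ae ?_
        filter_upwards [hae] with q hq
        rw [← ENNReal.mul_rpow_of_nonneg _ _ hα.le]
        exact ENNReal.rpow_le_rpow (hbound q hq) hα.le
    _ = K * blochSeminorm F ^ p * muMeasure a Set.univ ^ (1 / α) := by
        rw [lintegral_const, ENNReal.mul_rpow_of_nonneg _ _ (by positivity), ← ENNReal.rpow_mul,
          mul_one_div_cancel hα.ne', ENNReal.rpow_one]
    _ ≤ K * blochSeminorm F ^ p * (volume disc * volume disc) ^ (1 / α) := by
        gcongr
        exact muMeasure_univ_le (mem_ball_zero_iff.mp ha)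
    _ = _ := by ring

theorem theorem4 (α α' p : ℝ) (hα₁ : 1 < α) (hα₂ : α < 2) (hαα' : 1 / α + 1 / α' = 1)
    (hp : α' ≤ p) :
    ∃ c C : ℝ≥0, 0 < c ∧ 0 < C ∧
      ∀ F : ℂ → ℂ, DifferentiableOn ℂ F disc → F 0 = 0 →
        (c : ℝ≥0∞) * blochSeminorm F ^ p ≤ (⨅ ω ∈ weightClass F p α', weightedSup F α ω) ∧
        (⨅ ω ∈ weightClass F p α', weightedSup F α ω) ≤ (C : ℝ≥0∞) * blochSeminorm F ^ p := by
  have hconj : α.HolderConjugate α' :=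
    Real.holderConjugate_iff.mpr ⟨hα₁, by simpa only [one_div] using hαα'⟩
  have hα0 : 0 < α := hconj.pos
  have hα'0 : 0 < α' := hconj.symm.pos
  have hp1 : 1 < p := hconj.symm.lt.trans_le hp
  have hp0 : 0 < p := by linarith
  have hV0 : volume disc ≠ 0 := (Metric.measure_ball_pos volume 0 one_pos).ne'
  have hVt : volume disc ≠ ∞ := measure_ball_lt_top.ne
  have hW0 : volume disc * volume disc ≠ 0 := mul_ne_zero hV0 hV0
  have hWt : volume disc * volume disc ≠ ∞ := ENNReal.mul_ne_top hVt hVt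
  lift volume disc * volume disc to ℝ≥0 using hWt with W hW
  have hW0' : W ≠ 0 := by exact_mod_cast hW0
  have hWpos : 0 < W := pos_iff_ne_zero.mpr hW0'
  -- `K = W^(1/α')` solves `K^α' = W`, the mass bound; the other factor `W^(1/α)` is the mass inside
  -- the functional.
  refine ⟨((1 / 2) ^ p * Real.pi ^ 2 / 419904).toNNReal, W ^ (1 / α') * W ^ (1 / α),
    Real.toNNReal_pos.mpr (by positivity), by positivity, fun F hF _ => ⟨?_, ?_⟩⟩
  · refine le_iInf₂ fun ω hω => ?_
    have hsup : blochSeminorm F ^ p =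
        ⨆ a ∈ disc, (‖deriv F a‖ₑ * ENNReal.ofReal (1 - ‖a‖)) ^ p := by
      have := (ENNReal.orderIsoRpow p hp0).map_iSup₂
        fun a (_ : a ∈ disc) => ‖deriv F a‖ₑ * ENNReal.ofReal (1 - ‖a‖)
      rw [blochSeminorm]
      simpa only [ENNReal.orderIsoRpow_apply] using this
    rw [hsup, ENNReal.mul_iSup]
    refine iSup_le fun a => ?_
    rw [ENNReal.mul_iSup]
    exact iSup_le fun ha => (enorm_deriv_mul_rpow_le_lintegral_muMeasure hF hp1.le
      (mem_ball_zero_iff.mp ha)).trans (lintegral_muMeasure_le_weightedSup hconj hp1 hω ha)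
  · have hK : volume disc * volume disc ≤ ((W ^ (1 / α') : ℝ≥0) : ℝ≥0∞) ^ α' := by
      rw [← hW, ← ENNReal.coe_rpow_of_nonneg _ hα'0.le, ← NNReal.rpow_mul,
        one_div_mul_cancel hα'0.ne', NNReal.rpow_one]
    refine (iInf₂_le _ (derivWeight_mem_weightClass hα'0 hp1
      (NNReal.rpow_pos hWpos).ne' hK F)).trans ?_
    refine (weightedSup_derivWeight_le hα0 hp1 _ F).trans (le_of_eq ?_)
    rw [← hW, ENNReal.coe_mul, ENNReal.coe_rpow_of_nonneg _ (by positivity : 0 ≤ 1 / α)]
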